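/- Let $\mathbb{V}$ be a finitary one-sorted variety of universal algebras, i.e. the category of all algebras (with all homomorphisms) of a given finitary one-sorted signature that satisfy a given set of identities. A category is called \emph{weakly Mal'tsev} if (1) it has all pullbacks of split epimorphisms along split epimorphisms, and (2) for all $f\colon X\to Z$, $r\colon Z\to X$, $g\colon Y\to Z$, $s\colon Z\to Y$ with $fr=1_Z=gs$ and every pullback $p_1\colon X\times_Z Y\to X$, $p_2\colon X\times_Z Y\to Y$ of $f$ along $g$, the morphisms $e_1\colon X\to X\times_Z Y$ and $e_2\colon Y\to X\times_Z Y$ determined by $p_1e_1=1_X$, $p_2e_1=sf$, $p_1e_2=rg$, $p_2e_2=1_Y$ are jointly epimorphic, i.e. two morphisms $a,b\colon X\times_Z Y\to A$ with $ae_1=be_1$ and $ae_2=be_2$ are equal. Then $\mathbb{V}$ is a weakly Mal'tsev category if and only if there exist integers $k,m,N\geqslant 0$, binary terms $f_1,g_1,\ldots,f_k,g_k$, ternary terms $p_1,\ldots,p_m$, $(2(k+2m+1))$-ary terms $s_1,\ldots,s_N$, $(2(k+m+2))$-ary terms $\sigma_1,\ldots,\sigma_{N+1}$ and, for all $i\in\{1,\ldots,N+1\}$,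 $(k+m+1)$-ary terms $\eta^{(i)}_1,\eta^{(i)}_2,\epsilon^{(i)}_1,\epsilon^{(i)}_2$ in the signature of $\mathbb{V}$ such that the following identities hold in $\mathbb{V}$ (on variables $x$, $y$, $u$, $u'$, $\vec v=v_1,\ldots,v_k$, $\vec v'=v'_1,\ldots,v'_k$, $\vec w=w_1,\ldots,w_m$, $\vec w'=w'_1,\ldots,w'_m$): (a) for all $i\in\{1,\ldots,k\}$, $$f_i(x,x)=g_i(x,x);$$ (b) for all $i\in\{1,\ldots,N+1\}$ and $\alpha\in\{1,2\}$, $$\eta^{(i)}_\alpha(y,f_1(x,y),\ldots,f_k(x,y),p_1(x,x,y),\ldots,p_m(x,x,y))=\epsilon^{(i)}_\alpha(y,f_1(x,y),\ldots,f_k(x,y),p_1(x,x,y),\ldots,p_m(x,x,y)),$$ $$\eta^{(i)}_\alpha(x,g_1(x,y),\ldots,g_k(x,y),p_1(x,y,y),\ldots,p_m(x,y,y))=\epsilon^{(i)}_\alpha(x,g_1(x,y),\ldots,g_k(x,y),p_1(x,y,y),\ldots,p_m(x,y,y));$$ (c) for all $i\in\{1,\ldots,N\}$, $$\sigma_{i}(u,\vec{v},\vec{w},u',\vec{v}',\vec{w}',\epsilon^{(i)}_1(u,\vec{v},\vec{w}),\epsilon^{(i)}_2(u',\vec{v}',\vec{w}'))=s_{i}(u,\vec{v},\vec{w},\vec{w},u',\vec{v}',\vec{w}',\vec{w}'),$$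 $$s_{i}(u,\vec{v},\vec{w},\vec{w}',u',\vec{v}',\vec{w}',\vec{w})=\sigma_{i+1}(u,\vec{v},\vec{w},u',\vec{v}',\vec{w}',\eta^{(i+1)}_1(u,\vec{v},\vec{w}),\eta^{(i+1)}_2(u',\vec{v}',\vec{w}'));$$ (d) $$u=\sigma_1(u,\vec{v},\vec{w},u',\vec{v}',\vec{w}',\eta^{(1)}_1(u,\vec{v},\vec{w}),\eta^{(1)}_2(u',\vec{v}',\vec{w}')),$$ $$u'=\sigma_{N+1}(u,\vec{v},\vec{w},u',\vec{v}',\vec{w}',\epsilon^{(N+1)}_1(u,\vec{v},\vec{w}),\epsilon^{(N+1)}_2(u',\vec{v}',\vec{w}')).$$ -/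

import Mathlib

open CategoryTheory CategoryTheory.Limits

universe u v w

/-- A category is *weakly Mal'tsev* if it has all pullbacks of split epimorphisms along split
epimorphisms and if, for every such pullback `P` of `f` (split by `r`) and `g` (split by `s`), the
canonical injections `e₁ = ⟨1, s f⟩` and `e₂ = ⟨r g, 1⟩` are jointly epimorphic. -/
structure IsWeaklyMaltsevCategory (C : Type u) [Category.{v} C] : Prop where
  hasPullback : ∀ {X Y Z : C} (f : X ⟶ Z) (g : Y ⟶ Z), IsSplitEpi f → IsSplitEpi g →
    HasPullback f g
  jointlyEpi : ∀ {X Y Z P : C} (f : X ⟶ Z) (r : Z ⟶ X) (g : Y ⟶ Z) (s : Z ⟶ Y)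
    (p₁ : P ⟶ X) (p₂ : P ⟶ Y) (e₁ : X ⟶ P) (e₂ : Y ⟶ P),
    r ≫ f = 𝟙 Z → s ≫ g = 𝟙 Z → IsPullback p₁ p₂ f g →
    e₁ ≫ p₁ = 𝟙 X → e₁ ≫ p₂ = f ≫ s → e₂ ≫ p₁ = g ≫ r → e₂ ≫ p₂ = 𝟙 Y →
    ∀ {A : C} (a b : P ⟶ A), e₁ ≫ a = e₁ ≫ b → e₂ ≫ a = e₂ ≫ b → a = b

/-- The algebras of the variety of `L`-algebras defined by the set `E` of identities, where `L` is
a one-sorted finitary signature (a first-order language, used below only without relation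
symbols). An identity is a pair of terms in variables indexed by `ℕ`. The carrier may be empty. -/
structure VarietyAlgebra {L : FirstOrder.Language.{u, v}} (E : Set (L.Term ℕ × L.Term ℕ)) where
  carrier : Type w
  [str : L.Structure carrier]
  satisfies : ∀ e ∈ E, ∀ x : ℕ → carrier, e.1.realize x = e.2.realize x

attribute [instance] VarietyAlgebra.str

instance VarietyAlgebra.coeSort {L : FirstOrder.Language.{u, v}} (E : Set (L.Term ℕ × L.Term ℕ)) :
    CoeSort (VarietyAlgebra.{u, v, w} E) (Type w) := ⟨VarietyAlgebra.carrier⟩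

/-- The category of algebras of a variety, with all homomorphisms as morphisms. -/
instance VarietyAlgebra.category {L : FirstOrder.Language.{u, v}} (E : Set (L.Term ℕ × L.Term ℕ)) :
    Category.{w} (VarietyAlgebra.{u, v, w} E) where
  Hom A B := L.Hom A B
  id A := FirstOrder.Language.Hom.id L A
  comp f g := FirstOrder.Language.Hom.comp g f

/-- The `k + m + 1` variables `u, v₁, …, v_k, w₁, …, w_m` of the terms `η` and `ε`. -/
inductive EtaVar (k m : ℕ) : Type
  | u : EtaVar k m
  | v : Fin k → EtaVar k m
  | w : Fin m → EtaVar k m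

/-- The list of arguments `(u, v₁, …, v_k, w₁, …, w_m)`. -/
def EtaVar.args {k m : ℕ} {M : Type w} (a : M) (b : Fin k → M) (c : Fin m → M) :
    EtaVar k m → M
  | .u => a
  | .v i => b i
  | .w j => c j

/-- The `2 (k + m + 2)` variables of the terms `σ`, namely
`u, v₁, …, v_k, w₁, …, w_m, u', v'₁, …, v'_k, w'₁, …, w'_m` and two further ones. -/
inductive SigmaVar (k m : ℕ) : Type
  | left : EtaVar k m → SigmaVar k m
  | right : EtaVar k m → SigmaVar k m
  | fst : SigmaVar k m
  | snd : SigmaVar k m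

/-- The list of arguments `(u, v⃗, w⃗, u', v⃗', w⃗', y, z)`, where `l = (u, v⃗, w⃗)` and
`r = (u', v⃗', w⃗')`. -/
def SigmaVar.args {k m : ℕ} {M : Type w} (l r : EtaVar k m → M) (y z : M) : SigmaVar k m → M
  | .left i => l i
  | .right i => r i
  | .fst => y
  | .snd => z

/-- The `2 (k + 2 m + 1)` variables of the terms `s`, namely
`u, v₁, …, v_k, w₁, …, w_m, w̃₁, …, w̃_m` and
`u', v'₁, …, v'_k, w'₁, …, w'_m, w̃'₁, …, w̃'_m`. -/
inductive SVar (k m : ℕ) : Type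
  | left : EtaVar k m → SVar k m
  | leftTilde : Fin m → SVar k m
  | right : EtaVar k m → SVar k m
  | rightTilde : Fin m → SVar k m

/-- The list of arguments `(u, v⃗, w⃗, w̃, u', v⃗', w⃗', w̃')`, where `l = (u, v⃗, w⃗)` and
`r = (u', v⃗', w⃗')`. -/
def SVar.args {k m : ℕ} {M : Type w} (l : EtaVar k m → M) (lt : Fin m → M)
    (r : EtaVar k m → M) (rt : Fin m → M) : SVar k m → M
  | .left i => l i
  | .leftTilde j => lt j
  | .right i => r i
  | .rightTilde j => rt j

/-! Joint epimorphy says that two morphisms on a pullback `P` are equal if they agree on the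
subalgebra generated by the images of `e₁` and `e₂`. The generic instance is the kernel pair of the
codiagonal F(x, y) → F(z), with the sections z ↦ x and z ↦ y. There the images generate the
subalgebra D generated by (x, x), (x, y), (y, y), and the element to control is (y, x).

Necessity: glue two copies of this `P` along D by generators and relations. The two maps from `P`
agree on D, hence everywhere, so the two copies u, u' of (y, x) become equal
(`reflTransGen_step_of_isWeaklyMaltsevCategory`). Such an equality has a finite derivation, whose
steps apply relations η = ε of `P` in each copy or interchange names w, w' of the same element of D.
Alternating the two kinds (`exists_alternating_steps`) and keeping finitely many names gives (c) and
(d). The pairs (f_i, g_i) are elements of `P`, which is (a), the p_j name elements of D, and (b)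
expresses η = ε in `P` componentwise.

Sufficiency: in any pullback the terms f_i, g_i, p_j yield elements for which η = ε holds by (b).
Evaluated at their images under two morphisms, the chain (c), (d) joins the images of the given
element.

Free algebras are quotients of sets of terms, which accounts for the universe `max u w`. -/

namespace VarietyAlgebra

open FirstOrder FirstOrder.Language

/-! ### Pullbacks of algebras. -/

section Pullback

variable {L : FirstOrder.Language.{u, v}} {E : Set (L.Term ℕ × L.Term ℕ)}

/-- The homomorphism underlying a morphism of algebras. -/
def hom {A B : VarietyAlgebra.{u, v, w} E} (f : A ⟶ B) : A →[L] B := f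

/-- A homomorphism of algebras, as a morphism. -/
def ofHom {A B : VarietyAlgebra.{u, v, w} E} (f : A →[L] B) : A ⟶ B := f

theorem hom_comp_apply {A B C : VarietyAlgebra.{u, v, w} E} (f : A ⟶ B) (g : B ⟶ C) (x : A) :
    hom (f ≫ g) x = hom g (hom f x) := rfl

theorem hom_id_apply {A : VarietyAlgebra.{u, v, w} E} (x : A) : hom (𝟙 A) x = x := rfl

theorem morphism_ext {A B : VarietyAlgebra.{u, v, w} E} {f g : A ⟶ B}
    (h : ∀ x, hom f x = hom g x) : f = g :=
  FirstOrder.Language.Hom.ext h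

theorem hom_congr {A B : VarietyAlgebra.{u, v, w} E} {f g : A ⟶ B} (h : f = g) (x : A) :
    hom f x = hom g x := by rw [h]

theorem realize_hom {A B : VarietyAlgebra.{u, v, w} E} (f : A ⟶ B) {α : Type*}
    (t : L.Term α) (x : α → A) : hom f (t.realize x) = t.realize (fun a => hom f (x a)) :=
  (HomClass.realize_term (hom f)).symm

variable [L.IsAlgebraic] {X Y Z : VarietyAlgebra.{u, v, w} E}

/-- A map preserving the operations, as a homomorphism of algebras of an algebraic signature. -/
def homOfMapFun {M N : Type*} [L.Structure M] [L.Structure N] (φ : M → N)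
    (h : ∀ {n} (F : L.Functions n) (x : Fin n → M),
      φ (Structure.funMap F x) = Structure.funMap F (φ ∘ x)) : M →[L] N where
  toFun := φ
  map_fun' := h
  map_rel' R := isEmptyElim R

/-- The subset `{(x, y) | f x = g y}` of the product of two algebras. -/
def PullbackCarrier (f : X ⟶ Z) (g : Y ⟶ Z) : Type w :=
  {q : X × Y // hom f q.1 = hom g q.2}

instance pullbackStructure (f : X ⟶ Z) (g : Y ⟶ Z) : L.Structure (PullbackCarrier f g) where
  funMap F q := ⟨(Structure.funMap F fun i => (q i).1.1, Structure.funMap F fun i => (q i).1.2), by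
    rw [(hom f).map_fun, (hom g).map_fun]
    congr 1
    funext i
    exact (q i).2⟩
  RelMap R := isEmptyElim R

/-- The first projection of a pullback of algebras. -/
def pullbackFstHom (f : X ⟶ Z) (g : Y ⟶ Z) : PullbackCarrier f g →[L] X :=
  homOfMapFun (fun q => q.1.1) fun _ _ => rfl

/-- The second projection of a pullback of algebras. -/
def pullbackSndHom (f : X ⟶ Z) (g : Y ⟶ Z) : PullbackCarrier f g →[L] Y :=
  homOfMapFun (fun q => q.1.2) fun _ _ => rfl

theorem pullback_ext {f : X ⟶ Z} {g : Y ⟶ Z} {q q' : PullbackCarrier f g}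
    (h₁ : pullbackFstHom f g q = pullbackFstHom f g q')
    (h₂ : pullbackSndHom f g q = pullbackSndHom f g q') : q = q' :=
  Subtype.ext (Prod.ext h₁ h₂)

/-- The pullback of algebras. -/
def pullbackAlgebra (f : X ⟶ Z) (g : Y ⟶ Z) : VarietyAlgebra.{u, v, w} E where
  carrier := PullbackCarrier f g
  satisfies e he x := by
    apply pullback_ext
    · rw [← HomClass.realize_term, ← HomClass.realize_term, X.satisfies e he]
    · rw [← HomClass.realize_term, ← HomClass.realize_term, Y.satisfies e he]

/-- The first projection of a pullback of algebras, as a morphism. -/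
def pullbackFst (f : X ⟶ Z) (g : Y ⟶ Z) : pullbackAlgebra f g ⟶ X := pullbackFstHom f g

/-- The second projection of a pullback of algebras, as a morphism. -/
def pullbackSnd (f : X ⟶ Z) (g : Y ⟶ Z) : pullbackAlgebra f g ⟶ Y := pullbackSndHom f g

/-- The morphism into a pullback of algebras with given components. -/
def pullbackLift {f : X ⟶ Z} {g : Y ⟶ Z} {W : VarietyAlgebra.{u, v, w} E} (a : W ⟶ X) (b : W ⟶ Y)
    (h : a ≫ f = b ≫ g) : W ⟶ pullbackAlgebra f g :=
  ofHom (homOfMapFun (fun x => (⟨(hom a x, hom b x), hom_congr h x⟩ : PullbackCarrier f g))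
    fun F x => Subtype.ext (Prod.ext ((hom a).map_fun F x) ((hom b).map_fun F x)))

theorem isPullback_pullbackAlgebra (f : X ⟶ Z) (g : Y ⟶ Z) :
    IsPullback (pullbackFst f g) (pullbackSnd f g) f g where
  w := morphism_ext fun q => q.2
  isLimit' := ⟨PullbackCone.IsLimit.mk _
    (fun c => pullbackLift c.fst c.snd c.condition) (fun _ => rfl) (fun _ => rfl)
    (fun _ _ h₁ h₂ => morphism_ext fun x => pullback_ext (hom_congr h₁ x) (hom_congr h₂ x))⟩

/-- Elements of an arbitrary pullback are handled as pairs by comparison with the concrete one. -/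
theorem isPullback_ext {P : VarietyAlgebra.{u, v, w} E} {p₁ : P ⟶ X} {p₂ : P ⟶ Y} {f : X ⟶ Z}
    {g : Y ⟶ Z} (h : IsPullback p₁ p₂ f g) {q q' : P} (h₁ : hom p₁ q = hom p₁ q')
    (h₂ : hom p₂ q = hom p₂ q') : q = q' := by
  have key : pullbackLift p₁ p₂ h.w ≫
      h.lift (pullbackFst f g) (pullbackSnd f g) (isPullback_pullbackAlgebra f g).w = 𝟙 P := by
    apply h.hom_ext
    · rw [Category.assoc, h.lift_fst, Category.id_comp]; rfl
    · rw [Category.assoc, h.lift_snd, Category.id_comp]; rfl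
  rw [← hom_id_apply q, ← hom_id_apply q', ← key, hom_comp_apply, hom_comp_apply]
  exact congrArg _ (Subtype.ext (Prod.ext h₁ h₂))

theorem isPullback_exists {P : VarietyAlgebra.{u, v, w} E} {p₁ : P ⟶ X} {p₂ : P ⟶ Y} {f : X ⟶ Z}
    {g : Y ⟶ Z} (h : IsPullback p₁ p₂ f g) {x : X} {y : Y} (hxy : hom f x = hom g y) :
    ∃ q : P, hom p₁ q = x ∧ hom p₂ q = y :=
  ⟨hom (h.lift (pullbackFst f g) (pullbackSnd f g) (isPullback_pullbackAlgebra f g).w)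
      (⟨(x, y), hxy⟩ : PullbackCarrier f g),
    hom_congr (h.lift_fst _ _ (isPullback_pullbackAlgebra f g).w) _,
    hom_congr (h.lift_snd _ _ (isPullback_pullbackAlgebra f g).w) _⟩

theorem vecCons_two_comp {M N : Type*} (φ : M → N) (x y : M) :
    (fun i => φ (![x, y] i)) = ![φ x, φ y] := by
  funext i; fin_cases i <;> rfl

theorem vecCons_three_comp {M N : Type*} (φ : M → N) (x y z : M) :
    (fun i => φ (![x, y, z] i)) = ![φ x, φ y, φ z] := by
  funext i; fin_cases i <;> rfl

theorem etaVar_args_comp {k m : ℕ} {M N : Type*} (φ : M → N) (a : M) (b : Fin k → M)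
    (c : Fin m → M) :
    (fun i => φ (EtaVar.args a b c i)) =
      EtaVar.args (φ a) (fun i => φ (b i)) (fun i => φ (c i)) := by
  funext i; cases i <;> rfl

/-! ### Sufficiency of the term identities. -/

/-- The identities on terms that characterize weakly Mal'tsev varieties, in an algebra `A`. -/
def SatisfiesTermIdentities (A : VarietyAlgebra.{u, v, w} E) {k m N : ℕ}
    (f g : Fin k → L.Term (Fin 2)) (p : Fin m → L.Term (Fin 3)) (s : Fin N → L.Term (SVar k m))
    (σ : Fin (N + 1) → L.Term (SigmaVar k m))
    (η ε : Fin (N + 1) → Fin 2 → L.Term (EtaVar k m)) : Prop :=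
  (∀ (i : Fin k) (x : A), (f i).realize ![x, x] = (g i).realize ![x, x]) ∧
  (∀ (i : Fin (N + 1)) (α : Fin 2) (x y : A),
    (η i α).realize (EtaVar.args y (fun j => (f j).realize ![x, y])
        (fun j => (p j).realize ![x, x, y])) =
      (ε i α).realize (EtaVar.args y (fun j => (f j).realize ![x, y])
        (fun j => (p j).realize ![x, x, y])) ∧
    (η i α).realize (EtaVar.args x (fun j => (g j).realize ![x, y])
        (fun j => (p j).realize ![x, y, y])) =
      (ε i α).realize (EtaVar.args x (fun j => (g j).realize ![x, y])
        (fun j => (p j).realize ![x, y, y]))) ∧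
  (∀ (a a' : A) (b b' : Fin k → A) (c c' : Fin m → A),
    (∀ i : Fin N,
      (σ i.castSucc).realize (SigmaVar.args (EtaVar.args a b c) (EtaVar.args a' b' c')
          ((ε i.castSucc 0).realize (EtaVar.args a b c))
          ((ε i.castSucc 1).realize (EtaVar.args a' b' c'))) =
        (s i).realize (SVar.args (EtaVar.args a b c) c (EtaVar.args a' b' c') c') ∧
      (s i).realize (SVar.args (EtaVar.args a b c) c' (EtaVar.args a' b' c') c) =
        (σ i.succ).realize (SigmaVar.args (EtaVar.args a b c) (EtaVar.args a' b' c')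
          ((η i.succ 0).realize (EtaVar.args a b c))
          ((η i.succ 1).realize (EtaVar.args a' b' c')))) ∧
    a = (σ 0).realize (SigmaVar.args (EtaVar.args a b c) (EtaVar.args a' b' c')
          ((η 0 0).realize (EtaVar.args a b c))
          ((η 0 1).realize (EtaVar.args a' b' c'))) ∧
    a' = (σ (Fin.last N)).realize
          (SigmaVar.args (EtaVar.args a b c) (EtaVar.args a' b' c')
            ((ε (Fin.last N) 0).realize (EtaVar.args a b c))
            ((ε (Fin.last N) 1).realize (EtaVar.args a' b' c'))))

theorem isWeaklyMaltsevCategory_of_terms {k m N : ℕ}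
    (f g : Fin k → L.Term (Fin 2)) (p : Fin m → L.Term (Fin 3)) (s : Fin N → L.Term (SVar k m))
    (σ : Fin (N + 1) → L.Term (SigmaVar k m))
    (η ε : Fin (N + 1) → Fin 2 → L.Term (EtaVar k m))
    (H : ∀ A : VarietyAlgebra.{u, v, w} E, SatisfiesTermIdentities A f g p s σ η ε) :
    IsWeaklyMaltsevCategory (VarietyAlgebra.{u, v, w} E) where
  hasPullback f g _ _ := (isPullback_pullbackAlgebra f g).hasPullback
  jointlyEpi {X Y Z P} d r d' t p₁ p₂ e₁ e₂ hr ht hP h₁₁ h₁₂ h₂₁ h₂₂ A φ ψ hφ₁ hφ₂ := by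
    apply morphism_ext
    intro q
    set x := hom p₁ q with hx
    set y := hom p₂ q with hy
    have hxy : hom d x = hom d' y := hom_congr hP.w q
    set z := hom d x with hz
    have hr' (z : Z) : hom d (hom r z) = z := hom_congr hr z
    have ht' (z : Z) : hom d' (hom t z) = z := hom_congr ht z
    -- Over `Z` both sides become f_i(z, z) and g_i(z, z), equal by (a). Hence the pair is an
    -- element `b i` of `P`.
    have hb (i : Fin k) : hom d ((f i).realize ![hom r z, x]) =
        hom d' ((g i).realize ![y, hom t z]) := by
      rw [realize_hom, realize_hom, vecCons_two_comp, vecCons_two_comp, hr', ht', ← hxy, ← hz]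
      exact (H Z).1 i z
    choose b hb₁ hb₂ using fun i => isPullback_exists hP (hb i)
    -- The three arguments are the pairs (rz, y), (rz, tz), (x, tz). They lie in the images of `e₁`
    -- and `e₂`, so `φ` and `ψ` agree on `c j`.
    let c (j : Fin m) : P := (p j).realize ![hom e₂ y, hom e₁ (hom r z), hom e₁ x]
    have e₁₁ (x : X) : hom p₁ (hom e₁ x) = x := hom_congr h₁₁ x
    have e₁₂ (x : X) : hom p₂ (hom e₁ x) = hom t (hom d x) := hom_congr h₁₂ x
    have e₂₁ (y : Y) : hom p₁ (hom e₂ y) = hom r (hom d' y) := hom_congr h₂₁ y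
    have e₂₂ (y : Y) : hom p₂ (hom e₂ y) = y := hom_congr h₂₂ y
    have hc₁ (j) : hom p₁ (c j) = (p j).realize ![hom r z, hom r z, x] := by
      rw [realize_hom, vecCons_three_comp, e₁₁, e₁₁, e₂₁, ← hxy]
    have hc₂ (j) : hom p₂ (c j) = (p j).realize ![y, hom t z, hom t z] := by
      rw [realize_hom, vecCons_three_comp, e₁₂, e₁₂, e₂₂, hr', ← hz]
    have hηε (i α) : (η i α).realize (EtaVar.args q b c) = (ε i α).realize (EtaVar.args q b c) := by
      apply isPullback_ext hP
      · rw [realize_hom, realize_hom, etaVar_args_comp, funext hb₁, funext hc₁]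
        exact ((H X).2.1 i α (hom r z) x).1
      · rw [realize_hom, realize_hom, etaVar_args_comp, funext hb₂, funext hc₂]
        exact ((H Y).2.1 i α y (hom t z)).2
    have hφψ (j) : hom φ (c j) = hom ψ (c j) := by
      rw [realize_hom, realize_hom, vecCons_three_comp, vecCons_three_comp]
      rw [show hom φ (hom e₂ y) = hom ψ (hom e₂ y) from hom_congr hφ₂ y,
        show hom φ (hom e₁ x) = hom ψ (hom e₁ x) from hom_congr hφ₁ x,
        show hom φ (hom e₁ (hom r z)) = hom ψ (hom e₁ (hom r z)) from hom_congr hφ₁ _]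
    have hA (χ : P ⟶ A) (i α) :
        (η i α).realize (EtaVar.args (hom χ q) (fun j => hom χ (b j)) (fun j => hom χ (c j))) =
        (ε i α).realize (EtaVar.args (hom χ q) (fun j => hom χ (b j)) (fun j => hom χ (c j))) := by
      rw [← etaVar_args_comp, ← realize_hom, hηε, realize_hom]
    obtain ⟨hstep, hfirst, hlast⟩ := (H A).2.2 (hom φ q) (hom ψ q) (fun j => hom φ (b j))
      (fun j => hom ψ (b j)) (fun j => hom φ (c j)) (fun j => hom ψ (c j))
    -- `hA` must be used before `hφψ`, since it needs all entries of an argument list to be images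
    -- under the same morphism.
    simp only [hA] at hfirst hstep
    simp only [hφψ] at hfirst hstep hlast
    -- With η = ε and w = w' the swap in `s i` has no effect, so (c) makes this sequence constant,
    -- and (d) identifies its ends with `hom φ q` and `hom ψ q`.
    let F (i : Fin (N + 1)) : A := (σ i).realize (SigmaVar.args
      (EtaVar.args (hom φ q) (fun j => hom φ (b j)) (fun j => hom ψ (c j)))
      (EtaVar.args (hom ψ q) (fun j => hom ψ (b j)) (fun j => hom ψ (c j)))
      ((ε i 0).realize (EtaVar.args (hom φ q) (fun j => hom φ (b j)) (fun j => hom ψ (c j))))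
      ((ε i 1).realize (EtaVar.args (hom ψ q) (fun j => hom ψ (b j)) (fun j => hom ψ (c j)))))
    have hF (i : Fin (N + 1)) : F i = F 0 := by
      induction i using Fin.induction with
      | zero => rfl
      | succ i ih => rw [← ih]; exact ((hstep i).1.trans (hstep i).2).symm
    exact hfirst.trans ((hF (Fin.last N)).symm.trans hlast.symm)

end Pullback

/-! ### Quotients of term algebras and free algebras. -/

section Quotient

variable {L : FirstOrder.Language.{u, v}} (E : Set (L.Term ℕ × L.Term ℕ))

/-- The relation between terms `t` and `t'` which says that the identity `t = t'` holds in the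
variety. -/
def TermEquiv {α : Type*} (t t' : L.Term α) : Prop :=
  ∀ (A : VarietyAlgebra.{u, v, w} E) (x : α → A), t.realize x = t'.realize x

/-- A congruence on the algebra of terms that contains all identities of the variety. -/
structure TermCongruence (α : Type (max u w)) extends Setoid (L.Term α) where
  func_congr : ∀ {n} (F : L.Functions n) (a b : Fin n → L.Term α), (∀ i, r (a i) (b i)) →
    r (Term.func F a) (Term.func F b)
  of_equiv : ∀ {t t'}, TermEquiv.{u, v, max u w} E t t' → r t t'

variable {E}

namespace TermCongruence

variable {α : Type (max u w)} (c : TermCongruence.{u, v, w} E α)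

/-- The set of classes of a congruence on terms. -/
def Carrier : Type (max u w) := Quotient c.toSetoid

/-- The class of a term. -/
def cls (t : L.Term α) : c.Carrier := Quotient.mk c.toSetoid t

/-- A representative of a class. -/
noncomputable def out (q : c.Carrier) : L.Term α := Quotient.out q

theorem cls_out (q : c.Carrier) : c.cls (c.out q) = q := Quotient.out_eq q

variable {c} in
theorem cls_eq_cls {t t' : L.Term α} : c.cls t = c.cls t' ↔ c.r t t' := Quotient.eq

variable [L.IsAlgebraic]

noncomputable instance : L.Structure c.Carrier where
  funMap F q := c.cls (Term.func F fun i => c.out (q i))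
  RelMap R := isEmptyElim R

theorem funMap_cls {n} (F : L.Functions n) (t : Fin n → L.Term α) :
    Structure.funMap F (fun i => c.cls (t i)) = c.cls (Term.func F t) :=
  cls_eq_cls.2 (c.func_congr F _ _ fun _ => cls_eq_cls.1 (c.cls_out _))

theorem realize_cls {β : Type*} (t : L.Term β) (x : β → L.Term α) :
    t.realize (fun b => c.cls (x b)) = c.cls (t.subst x) := by
  induction t with
  | var => rfl
  | func F ts ih => simp only [Term.realize_func, Term.subst, ih, funMap_cls]

/-- The quotient of the algebra of terms by a congruence. -/
noncomputable def algebra : VarietyAlgebra.{u, v, max u w} E where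
  carrier := c.Carrier
  satisfies e he x := by
    rw [show x = fun n => c.cls (c.out (x n)) from funext fun n => (c.cls_out _).symm,
      realize_cls, realize_cls, cls_eq_cls]
    refine c.of_equiv fun A y => ?_
    rw [Term.realize_subst, Term.realize_subst, A.satisfies e he]

end TermCongruence

variable (E) in
/-- The congruence of all identities of the variety. -/
def freeCongruence (α : Type (max u w)) : TermCongruence.{u, v, w} E α where
  r := TermEquiv.{u, v, max u w} E
  iseqv := ⟨fun _ _ _ => rfl, fun h A x => (h A x).symm, fun h h' A x => (h A x).trans (h' A x)⟩
  func_congr F a b h A x := by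
    simp only [Term.realize_func, fun i => h i A x]
  of_equiv h := h

variable [L.IsAlgebraic]

variable (E) in
/-- The free algebra on `n` generators. -/
noncomputable def free (n : ℕ) : VarietyAlgebra.{u, v, max u w} E :=
  (freeCongruence.{u, v, w} E (ULift.{max u w} (Fin n))).algebra

/-- The generators of a free algebra. -/
def freeGen {n : ℕ} (i : Fin n) : free.{u, v, w} E n :=
  (freeCongruence.{u, v, w} E (ULift.{max u w} (Fin n))).cls (Term.var ⟨i⟩)

/-- A term that represents an element of a free algebra. -/
noncomputable def freeRep {n : ℕ} (q : free.{u, v, w} E n) : L.Term (Fin n) :=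
  ((freeCongruence.{u, v, w} E (ULift.{max u w} (Fin n))).out q).relabel ULift.down

theorem realize_freeRep {n : ℕ} (q : free.{u, v, w} E n) : (freeRep q).realize freeGen = q := by
  set c := freeCongruence.{u, v, w} E (ULift.{max u w} (Fin n)) with hc
  rw [freeRep, Term.realize_relabel]
  refine (c.realize_cls (c.out q) Term.var).trans ?_
  refine Eq.trans ?_ (c.cls_out q)
  refine congrArg c.cls ?_
  -- What remains is that substituting each variable for itself does not change a term.
  generalize c.out q = t
  induction t with
  | var => rfl
  | func F ts ih => simp only [Term.subst, ih]

/-- The morphism from a free algebra with given values on the generators. -/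
noncomputable def freeLift {n : ℕ} {A : VarietyAlgebra.{u, v, max u w} E} (x : Fin n → A) :
    free.{u, v, w} E n ⟶ A :=
  ofHom (homOfMapFun (M := (freeCongruence.{u, v, w} E (ULift.{max u w} (Fin n))).Carrier)
    (Quotient.lift (fun t => t.realize (x ∘ ULift.down)) fun _ _ h => h A _) fun F q => by
      refine congrArg (Structure.funMap F) (funext fun i => ?_)
      exact congrArg (Quotient.lift (fun t : L.Term _ => t.realize (x ∘ ULift.down)) _)
        (TermCongruence.cls_out _ (q i)))

theorem hom_free_apply {n : ℕ} {A : VarietyAlgebra.{u, v, max u w} E} (φ : free.{u, v, w} E n ⟶ A)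
    (q : free.{u, v, w} E n) : hom φ q = (freeRep q).realize (fun i => hom φ (freeGen i)) := by
  rw [← realize_hom, realize_freeRep]

theorem freeLift_apply {n : ℕ} {A : VarietyAlgebra.{u, v, max u w} E} (x : Fin n → A)
    (q : free.{u, v, w} E n) : hom (freeLift.{u, v, w} x) q = (freeRep q).realize x :=
  hom_free_apply _ q

theorem free_hom_ext {n : ℕ} {A : VarietyAlgebra.{u, v, max u w} E} {φ ψ : free.{u, v, w} E n ⟶ A}
    (h : ∀ i, hom φ (freeGen i) = hom ψ (freeGen i)) : φ = ψ :=
  morphism_ext fun q => by rw [hom_free_apply, hom_free_apply, funext h]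

end Quotient

/-! ### Derivations from relations and swaps. -/

section Steps

variable {L : FirstOrder.Language.{u, v}} {E : Set (L.Term ℕ × L.Term ℕ)}
  {P : VarietyAlgebra.{u, v, max u w} E} {G : Type (max u w)} {W : Type u}

/-- Two terms in two copies of a set of generators of `P` are related if one arises from the other
by replacing values of terms on the first and on the second copy according to relations that hold
in `P`. -/
def RelationStep (ev : G → P) (t t' : L.Term (G ⊕ G)) : Prop :=
  ∃ (σ : L.Term ((G ⊕ G) ⊕ Fin 2)) (η ε : Fin 2 → L.Term G),
    (∀ α, (η α).realize ev = (ε α).realize ev) ∧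
    ∀ (A : VarietyAlgebra.{u, v, max u w} E) (x y : G → A),
      t.realize (Sum.elim x y) =
        σ.realize (Sum.elim (Sum.elim x y) ![(η 0).realize x, (η 1).realize y]) ∧
      t'.realize (Sum.elim x y) =
        σ.realize (Sum.elim (Sum.elim x y) ![(ε 0).realize x, (ε 1).realize y])

variable (E) in
/-- Two terms in two copies of a set of generators are related if one arises from the other by
interchanging some occurrences of the two copies of generators in the family `ω`. -/
def SwapStep (ω : W → G) (t t' : L.Term (G ⊕ G)) : Prop :=
  ∃ s : L.Term ((G ⊕ G) ⊕ (W ⊕ W)),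
    ∀ (A : VarietyAlgebra.{u, v, max u w} E) (x y : G → A),
      t.realize (Sum.elim x y) =
        s.realize (Sum.elim (Sum.elim x y) (Sum.elim (x ∘ ω) (y ∘ ω))) ∧
      t'.realize (Sum.elim x y) =
        s.realize (Sum.elim (Sum.elim x y) (Sum.elim (y ∘ ω) (x ∘ ω)))

/-- The union of the two kinds of steps between terms. -/
def Step (ev : G → P) (ω : W → G) (t t' : L.Term (G ⊕ G)) : Prop :=
  RelationStep ev t t' ∨ SwapStep E ω t t'

theorem RelationStep.symm {ev : G → P} {t t' : L.Term (G ⊕ G)} (h : RelationStep ev t t') :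
    RelationStep ev t' t := by
  obtain ⟨σ, η, ε, h, h'⟩ := h
  exact ⟨σ, ε, η, fun α => (h α).symm, fun A x y => (h' A x y).symm⟩

theorem SwapStep.symm {ω : W → G} {t t' : L.Term (G ⊕ G)} (h : SwapStep E ω t t') :
    SwapStep E ω t' t := by
  obtain ⟨s, h⟩ := h
  -- Exchanging the two families of slots of `s` exchanges its two evaluations.
  refine ⟨s.relabel (Sum.map id Sum.swap), fun A x y => ?_⟩
  rw [Term.realize_relabel, Term.realize_relabel, Sum.elim_comp_map, Sum.elim_comp_map]
  simpa using (h A x y).symm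

/-- Identities of the variety need no third kind of step: they are relation steps whose slots are
unused and filled with a dummy variable. -/
theorem RelationStep.of_equiv [Nonempty G] (ev : G → P) {t t' : L.Term (G ⊕ G)}
    (h : TermEquiv.{u, v, max u w} E t t') : RelationStep ev t t' :=
  ⟨t.relabel Sum.inl, fun _ => Term.var (Classical.arbitrary G),
    fun _ => Term.var (Classical.arbitrary G), fun _ => rfl, fun A x y => by
      simp only [Term.realize_relabel, Sum.elim_comp_inl]
      exact ⟨trivial, (h A _).symm⟩⟩

theorem SwapStep.refl (ω : W → G) (t : L.Term (G ⊕ G)) : SwapStep E ω t t :=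
  ⟨t.relabel Sum.inl, fun A x y => by
    rw [Term.realize_relabel, Term.realize_relabel, Sum.elim_comp_inl, Sum.elim_comp_inl]
    exact ⟨rfl, rfl⟩⟩

theorem realize_func_update {M : Type*} [L.Structure M] {α : Type*} {n : ℕ} (F : L.Functions n)
    (a : Fin n → L.Term α) (i : Fin n) (t : L.Term α) (x : α → M) :
    (Term.func F (Function.update a i t)).realize x =
      Structure.funMap F (Function.update (fun j => (a j).realize x) i (t.realize x)) := by
  rw [Term.realize_func]
  congr 1
  funext j
  exact Function.apply_update (fun _ s => Term.realize x s) a i t j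

/-- The operation and its other arguments are absorbed into `σ`. Only one argument changes, because
`σ` has just one slot for each copy. -/
theorem RelationStep.func_update {ev : G → P} {t t' : L.Term (G ⊕ G)} (h : RelationStep ev t t')
    {n : ℕ} (F : L.Functions n) (a : Fin n → L.Term (G ⊕ G)) (i : Fin n) :
    RelationStep ev (Term.func F (Function.update a i t))
      (Term.func F (Function.update a i t')) := by
  obtain ⟨σ, η, ε, h, h'⟩ := h
  refine ⟨Term.func F (Function.update (fun j => (a j).relabel Sum.inl) i σ), η, ε, h,
    fun A x y => ?_⟩
  rw [realize_func_update, realize_func_update, realize_func_update, realize_func_update,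
    (h' A x y).1, (h' A x y).2]
  simp only [Term.realize_relabel, Sum.elim_comp_inl, and_self]

theorem SwapStep.func_update {ω : W → G} {t t' : L.Term (G ⊕ G)} (h : SwapStep E ω t t')
    {n : ℕ} (F : L.Functions n) (a : Fin n → L.Term (G ⊕ G)) (i : Fin n) :
    SwapStep E ω (Term.func F (Function.update a i t))
      (Term.func F (Function.update a i t')) := by
  obtain ⟨s, h⟩ := h
  refine ⟨Term.func F (Function.update (fun j => (a j).relabel Sum.inl) i s), fun A x y => ?_⟩
  rw [realize_func_update, realize_func_update, realize_func_update, realize_func_update,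
    (h A x y).1, (h A x y).2]
  simp only [Term.realize_relabel, Sum.elim_comp_inl, and_self]

theorem Step.func_update {ev : G → P} {ω : W → G} {t t' : L.Term (G ⊕ G)} (h : Step ev ω t t')
    {n : ℕ} (F : L.Functions n) (a : Fin n → L.Term (G ⊕ G)) (i : Fin n) :
    Step ev ω (Term.func F (Function.update a i t)) (Term.func F (Function.update a i t')) :=
  h.imp (fun h => h.func_update F a i) (fun h => h.func_update F a i)

theorem RelationStep.left {ev : G → P} [Nonempty G] {η ε : L.Term G}
    (h : η.realize ev = ε.realize ev) :
    RelationStep ev (η.relabel Sum.inl) (ε.relabel Sum.inl) :=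
  ⟨Term.var (Sum.inr 0), ![η, Term.var (Classical.arbitrary G)],
    ![ε, Term.var (Classical.arbitrary G)], by simp [Fin.forall_fin_two, h], fun A x y => by
      simp [Sum.elim_comp_inl]⟩

theorem RelationStep.right {ev : G → P} [Nonempty G] {η ε : L.Term G}
    (h : η.realize ev = ε.realize ev) :
    RelationStep ev (η.relabel Sum.inr) (ε.relabel Sum.inr) :=
  ⟨Term.var (Sum.inr 1), ![Term.var (Classical.arbitrary G), η],
    ![Term.var (Classical.arbitrary G), ε], by simp [Fin.forall_fin_two, h], fun A x y => by
      simp [Sum.elim_comp_inr]⟩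

theorem SwapStep.var (ω : W → G) (j : W) :
    SwapStep E ω (Term.var (Sum.inl (ω j))) (Term.var (Sum.inr (ω j))) :=
  ⟨Term.var (Sum.inr (Sum.inl j)), fun _ _ _ => ⟨rfl, rfl⟩⟩

/-- A relation on terms that is compatible with the operations in each argument separately has a
compatible reflexive transitive closure. -/
theorem reflTransGen_func {α : Type*} {R : L.Term α → L.Term α → Prop} {n : ℕ} (F : L.Functions n)
    (hR : ∀ (a : Fin n → L.Term α) i {t t'}, R t t' →
      R (Term.func F (Function.update a i t)) (Term.func F (Function.update a i t')))
    (a b : Fin n → L.Term α) (h : ∀ i, Relation.ReflTransGen R (a i) (b i)) :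
    Relation.ReflTransGen R (Term.func F a) (Term.func F b) := by
  -- The arguments are replaced one at a time; `S` holds the positions already replaced.
  have key (S : Finset (Fin n)) :
      Relation.ReflTransGen R (Term.func F a) (Term.func F (S.piecewise b a)) := by
    induction S using Finset.induction with
    | empty => rw [Finset.piecewise_empty]
    | insert j S hj ih =>
      refine ih.trans ?_
      have hself : S.piecewise b a = Function.update (S.piecewise b a) j (a j) := by
        rw [← Finset.piecewise_eq_of_notMem S b a hj, Function.update_eq_self]
      rw [Finset.piecewise_insert]
      nth_rewrite 1 [hself]
      exact Relation.ReflTransGen.lift (fun t => Term.func F (Function.update (S.piecewise b a) j t))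
        (fun _ _ h => hR _ j h) _ _ (h j)
  simpa using key Finset.univ

/-- The congruence on terms in two copies of a set of generators that is generated by the steps. -/
def stepCongruence [Nonempty G] (ev : G → P) (ω : W → G) :
    TermCongruence.{u, v, w} E (G ⊕ G) where
  r := Relation.ReflTransGen (Step ev ω)
  iseqv :=
    have : Std.Symm (Step ev ω) := ⟨fun _ _ h => h.imp (fun h => h.symm) (fun h => h.symm)⟩
    ⟨fun _ => .refl, fun h => Std.Symm.symm _ _ h, fun h h' => h.trans h'⟩
  func_congr F := reflTransGen_func F fun a i _ _ h => h.func_update F a i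
  of_equiv h := .single (.inl (.of_equiv ev h))

/-- Steps can be arranged such that the two kinds alternate. -/
theorem exists_alternating_steps [Nonempty G] {ev : G → P} {ω : W → G} {t t' : L.Term (G ⊕ G)}
    (h : Relation.ReflTransGen (Step ev ω) t t') :
    ∃ (N : ℕ) (a b : ℕ → L.Term (G ⊕ G)), a 0 = t ∧ b N = t' ∧
      (∀ i ≤ N, RelationStep ev (a i) (b i)) ∧ ∀ i < N, SwapStep E ω (b i) (a (i + 1)) := by
  have hrefl (t : L.Term (G ⊕ G)) : RelationStep ev t t := .of_equiv ev fun _ _ => rfl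
  induction h with
  | refl => exact ⟨0, fun _ => t, fun _ => t, rfl, rfl, fun _ _ => hrefl t, by simp⟩
  | @tail r r' _ h ih =>
    obtain ⟨N, a, b, ha, hb, hrel, hswap⟩ := ih
    -- Either kind of step is a swap followed by a relation step, one of the two being trivial. Each
    -- induction step thus adds one swap and one relation step.
    obtain ⟨q, hq, hq'⟩ : ∃ q, SwapStep E ω r q ∧ RelationStep ev q r' := by
      rcases h with h | h
      exacts [⟨r, .refl ω r, h⟩, ⟨r', h, hrefl r'⟩]
    refine ⟨N + 1, fun i => if i ≤ N then a i else q, fun i => if i ≤ N then b i else r',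
      by simpa using ha, by simp, fun i hi => ?_, fun i hi => ?_⟩
    · by_cases h : i ≤ N
      · simpa [h] using hrel i h
      · simpa [h] using hq'
    · have hi' : i ≤ N := by omega
      by_cases h : i + 1 ≤ N
      · simpa [h, hi'] using hswap i h
      · obtain rfl : i = N := by omega
        simpa [hb] using hq

end Steps

/-! ### Reduction to finitely many variables. -/

/-- Indices for a distinguished generator and two families of generators. -/
inductive GenVar (V : Type*) (W : Type*)
  | u : GenVar V W
  | v : V → GenVar V W
  | w : W → GenVar V W

/-- The map of generators induced by maps of the two families to finite families. -/
def GenVar.reindex {V W : Type*} {k m : ℕ} (ρ : V → Fin k) (τ : W → Fin m) :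
    GenVar V W → EtaVar k m
  | .u => .u
  | .v q => .v (ρ q)
  | .w t => .w (τ t)

theorem exists_finite_retraction {V : Type*} [Nonempty V] {S : Set V} (hS : S.Finite) :
    ∃ (k : ℕ) (ι : Fin k → V) (ρ : V → Fin k), ∀ q ∈ S, ι (ρ q) = q := by
  classical
  -- The additional point gives `ρ` a default value outside `T`, even if `S` is empty.
  let T := insert (Classical.arbitrary V) hS.toFinset
  have hT : Classical.arbitrary V ∈ T := Finset.mem_insert_self _ _
  refine ⟨T.card, fun i => T.equivFin.symm i,
    fun q => if h : q ∈ T then T.equivFin ⟨q, h⟩ else T.equivFin ⟨_, hT⟩, fun q hq => ?_⟩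
  have : q ∈ T := Finset.mem_insert_of_mem (hS.mem_toFinset.2 hq)
  simp [this]

theorem realize_congr_of_mem_varFinset {L : FirstOrder.Language.{u, v}} {M : Type*} [L.Structure M]
    {α : Type*} [DecidableEq α] {t : L.Term α} {x y : α → M} (h : ∀ a ∈ t.varFinset, x a = y a) :
    t.realize x = t.realize y := by
  induction t with
  | var a => exact h a (Finset.mem_singleton_self a)
  | func F ts ih =>
    rw [Term.realize_func, Term.realize_func]
    congr 1
    funext i
    exact ih i fun a ha => h a (Finset.mem_biUnion.2 ⟨i, Finset.mem_univ i, ha⟩)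

/-! ### The generic pullback and necessity of the term identities. -/

section Generic

variable {L : FirstOrder.Language.{u, v}} [L.IsAlgebraic] (E : Set (L.Term ℕ × L.Term ℕ))

/-- The codiagonal of the free algebra on two generators. -/
noncomputable def codiagonal : free.{u, v, w} E 2 ⟶ free.{u, v, w} E 1 :=
  freeLift fun _ => freeGen 0

/-- The section of the codiagonal given by one of the two generators. -/
noncomputable def codiagonalSection (i : Fin 2) : free.{u, v, w} E 1 ⟶ free.{u, v, w} E 2 :=
  freeLift fun _ => freeGen i

theorem codiagonalSection_codiagonal (i : Fin 2) :
    codiagonalSection.{u, v, w} E i ≫ codiagonal E = 𝟙 _ :=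
  free_hom_ext fun j => by rw [Subsingleton.elim j 0]; rfl

/-- The kernel pair of the codiagonal. -/
noncomputable def genericPullback : VarietyAlgebra.{u, v, max u w} E :=
  pullbackAlgebra (codiagonal.{u, v, w} E) (codiagonal E)

/-- The first projection of the kernel pair of the codiagonal. -/
noncomputable def genericFst : genericPullback.{u, v, w} E ⟶ free.{u, v, w} E 2 :=
  pullbackFst (codiagonal E) (codiagonal E)

/-- The second projection of the kernel pair of the codiagonal. -/
noncomputable def genericSnd : genericPullback.{u, v, w} E ⟶ free.{u, v, w} E 2 :=
  pullbackSnd (codiagonal E) (codiagonal E)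

theorem isPullback_genericPullback :
    IsPullback (genericFst.{u, v, w} E) (genericSnd E) (codiagonal E) (codiagonal E) :=
  isPullback_pullbackAlgebra _ _

/-- A pair of generators, as an element of the kernel pair of the codiagonal. -/
noncomputable def genericPair (i j : Fin 2) : genericPullback.{u, v, w} E :=
  (⟨(freeGen i, freeGen j), rfl⟩ : PullbackCarrier (codiagonal.{u, v, w} E) (codiagonal E))

/-- The first canonical morphism into the kernel pair of the codiagonal. -/
noncomputable def genericInl : free.{u, v, w} E 2 ⟶ genericPullback.{u, v, w} E :=
  pullbackLift (𝟙 _) (codiagonal E ≫ codiagonalSection E 1) (by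
    rw [Category.assoc, codiagonalSection_codiagonal, Category.id_comp, Category.comp_id])

/-- The second canonical morphism into the kernel pair of the codiagonal. -/
noncomputable def genericInr : free.{u, v, w} E 2 ⟶ genericPullback.{u, v, w} E :=
  pullbackLift (codiagonal E ≫ codiagonalSection E 0) (𝟙 _) (by
    rw [Category.assoc, codiagonalSection_codiagonal, Category.id_comp, Category.comp_id])

/-- The values of the generators in the kernel pair of the codiagonal: the distinguished one is the
pair `(y, x)`, those of the first family are all elements, and those of the second family are the
elements generated by `(x, x)`, `(x, y)` and `(y, y)`. -/
noncomputable def genericEval :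
    GenVar (genericPullback.{u, v, w} E) (L.Term (Fin 3)) → genericPullback.{u, v, w} E
  | .u => genericPair E 1 0
  | .v q => q
  | .w t => t.realize ![genericPair E 0 0, genericPair E 0 1, genericPair E 1 1]

instance : Nonempty (GenVar (genericPullback.{u, v, w} E) (L.Term (Fin 3))) := ⟨.u⟩

instance : Nonempty (genericPullback.{u, v, w} E) := ⟨genericPair E 1 0⟩

/-- The congruence that presents the cokernel pair of the inclusion of the subalgebra generated by
`(x, x)`, `(x, y)` and `(y, y)`. -/
noncomputable def genericCongruence : TermCongruence.{u, v, w} E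
    (GenVar (genericPullback.{u, v, w} E) (L.Term (Fin 3)) ⊕
      GenVar (genericPullback.{u, v, w} E) (L.Term (Fin 3))) :=
  stepCongruence (genericEval.{u, v, w} E) GenVar.w

/-- The first of the cokernel pair. -/
noncomputable def cokernelInl :
    genericPullback.{u, v, w} E ⟶ (genericCongruence.{u, v, w} E).algebra :=
  ofHom (homOfMapFun (N := (genericCongruence.{u, v, w} E).Carrier)
    (fun q => (genericCongruence.{u, v, w} E).cls (Term.var (Sum.inl (.v q)))) fun F q => by
      refine Eq.trans ?_ (TermCongruence.funMap_cls _ F _).symm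
      refine TermCongruence.cls_eq_cls.2 (.single (.inl ?_))
      exact RelationStep.left (ev := genericEval.{u, v, w} E)
        (η := Term.var (.v (Structure.funMap F q)))
        (ε := Term.func F fun i => Term.var (.v (q i))) rfl)

/-- The second of the cokernel pair. -/
noncomputable def cokernelInr :
    genericPullback.{u, v, w} E ⟶ (genericCongruence.{u, v, w} E).algebra :=
  ofHom (homOfMapFun (N := (genericCongruence.{u, v, w} E).Carrier)
    (fun q => (genericCongruence.{u, v, w} E).cls (Term.var (Sum.inr (.v q)))) fun F q => by
      refine Eq.trans ?_ (TermCongruence.funMap_cls _ F _).symm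
      refine TermCongruence.cls_eq_cls.2 (.single (.inl ?_))
      exact RelationStep.right (ev := genericEval.{u, v, w} E)
        (η := Term.var (.v (Structure.funMap F q)))
        (ε := Term.func F fun i => Term.var (.v (q i))) rfl)

/-- An element of the kernel pair may have several names. Any name z equals the name `.v` of its
value, as this is a relation that holds in the kernel pair. -/
theorem cokernelInl_genericEval (z : GenVar (genericPullback.{u, v, w} E) (L.Term (Fin 3))) :
    hom (cokernelInl.{u, v, w} E) (genericEval.{u, v, w} E z) =
      (genericCongruence.{u, v, w} E).cls (Term.var (Sum.inl z)) :=
  TermCongruence.cls_eq_cls.2 (.single (.inl (RelationStep.left (ev := genericEval.{u, v, w} E)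
    (η := Term.var (.v (genericEval.{u, v, w} E z))) (ε := Term.var z) rfl)))

theorem cokernelInr_genericEval (z : GenVar (genericPullback.{u, v, w} E) (L.Term (Fin 3))) :
    hom (cokernelInr.{u, v, w} E) (genericEval.{u, v, w} E z) =
      (genericCongruence.{u, v, w} E).cls (Term.var (Sum.inr z)) :=
  TermCongruence.cls_eq_cls.2 (.single (.inl (RelationStep.right (ev := genericEval.{u, v, w} E)
    (η := Term.var (.v (genericEval.{u, v, w} E z))) (ε := Term.var z) rfl)))

theorem cokernelInl_eq_cokernelInr (t : L.Term (Fin 3)) :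
    hom (cokernelInl.{u, v, w} E) (genericEval.{u, v, w} E (.w t)) =
      hom (cokernelInr.{u, v, w} E) (genericEval.{u, v, w} E (.w t)) := by
  rw [cokernelInl_genericEval, cokernelInr_genericEval]
  exact TermCongruence.cls_eq_cls.2 (.single (.inr (SwapStep.var GenVar.w t)))

/-- The first injection sends x to (x, y) and y to (y, y), the entries 1 and 2 of the list of
generators of D; the second one uses the entries 0 and 1. -/
theorem genericInl_apply (q : free.{u, v, w} E 2) :
    hom (genericInl E) q = genericEval E (.w ((freeRep q).relabel ![1, 2])) := by
  rw [hom_free_apply, genericEval, Term.realize_relabel]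
  congr 1
  funext i
  fin_cases i <;> rfl

theorem genericInr_apply (q : free.{u, v, w} E 2) :
    hom (genericInr E) q = genericEval E (.w ((freeRep q).relabel ![0, 1])) := by
  rw [hom_free_apply, genericEval, Term.realize_relabel]
  congr 1
  funext i
  fin_cases i <;> rfl

variable {E}

theorem reflTransGen_step_of_isWeaklyMaltsevCategory
    (h : IsWeaklyMaltsevCategory (VarietyAlgebra.{u, v, max u w} E)) :
    Relation.ReflTransGen (Step (genericEval.{u, v, w} E) GenVar.w)
      (Term.var (Sum.inl .u)) (Term.var (Sum.inr .u)) := by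
  have key : cokernelInl.{u, v, w} E = cokernelInr E := by
    refine h.jointlyEpi (codiagonal E) (codiagonalSection E 0) (codiagonal E)
      (codiagonalSection E 1) (genericFst E) (genericSnd E) (genericInl E) (genericInr E)
      (codiagonalSection_codiagonal E 0) (codiagonalSection_codiagonal E 1)
      (isPullback_genericPullback E) rfl rfl rfl rfl _ _ ?_ ?_
    · refine morphism_ext fun q => ?_
      rw [hom_comp_apply, hom_comp_apply, genericInl_apply, cokernelInl_eq_cokernelInr]
    · refine morphism_ext fun q => ?_
      rw [hom_comp_apply, hom_comp_apply, genericInr_apply, cokernelInl_eq_cokernelInr]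
  have := hom_congr key (genericEval E .u)
  rw [cokernelInl_genericEval, cokernelInr_genericEval] at this
  exact TermCongruence.cls_eq_cls.1 this

/-- The first components of (y, x) and of (x, x), (x, y), (y, y) are y and x, x, y. This produces
the argument lists of the first half of (b), and second components produce the other half. -/
theorem hom_fst_genericEval {A : VarietyAlgebra.{u, v, max u w} E} (x y : A)
    (z : GenVar (genericPullback.{u, v, w} E) (L.Term (Fin 3))) :
    hom (genericFst.{u, v, w} E ≫ freeLift ![x, y]) (genericEval E z) =
    match z with
    | .u => y
    | .v q => (freeRep (hom (genericFst.{u, v, w} E) q)).realize ![x, y]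
    | .w t => t.realize ![x, x, y] := by
  cases z with
  | u => rfl
  | v q => exact freeLift_apply _ _
  | w t => exact (realize_hom _ t _).trans (congrArg (t.realize ·) (vecCons_three_comp _ _ _ _))

theorem hom_snd_genericEval {A : VarietyAlgebra.{u, v, max u w} E} (x y : A)
    (z : GenVar (genericPullback.{u, v, w} E) (L.Term (Fin 3))) :
    hom (genericSnd.{u, v, w} E ≫ freeLift ![x, y]) (genericEval E z) =
    match z with
    | .u => x
    | .v q => (freeRep (hom (genericSnd.{u, v, w} E) q)).realize ![x, y]
    | .w t => t.realize ![x, y, y] := by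
  cases z with
  | u => rfl
  | v q => exact freeLift_apply _ _
  | w t => exact (realize_hom _ t _).trans (congrArg (t.realize ·) (vecCons_three_comp _ _ _ _))

theorem realize_freeRep_diagonal {A : VarietyAlgebra.{u, v, max u w} E} (x : A)
    (q : genericPullback.{u, v, w} E) :
    (freeRep (hom (genericFst.{u, v, w} E) q)).realize ![x, x] =
    (freeRep (hom (genericSnd.{u, v, w} E) q)).realize ![x, x] := by
  -- Evaluation at equal arguments factors through the codiagonal, which equalizes the two
  -- components of `q`.
  have h : freeLift.{u, v, w} ![x, x] = codiagonal E ≫ freeLift ![x] :=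
    free_hom_ext fun i => by fin_cases i <;> rfl
  rw [← freeLift_apply, ← freeLift_apply, h]
  exact congrArg (hom (freeLift ![x]))
    (hom_congr (isPullback_genericPullback.{u, v, w} E).w q)

theorem exists_terms_of_isWeaklyMaltsevCategory
    (h : IsWeaklyMaltsevCategory (VarietyAlgebra.{u, v, max u w} E)) :
    ∃ (k m N : ℕ) (f g : Fin k → L.Term (Fin 2)) (p : Fin m → L.Term (Fin 3))
      (s : Fin N → L.Term (SVar k m)) (σ : Fin (N + 1) → L.Term (SigmaVar k m))
      (η ε : Fin (N + 1) → Fin 2 → L.Term (EtaVar k m)),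
      ∀ A : VarietyAlgebra.{u, v, max u w} E, SatisfiesTermIdentities A f g p s σ η ε := by
  classical
  obtain ⟨N, a, b, ha, hb, hrel, hswap⟩ :=
    exists_alternating_steps (reflTransGen_step_of_isWeaklyMaltsevCategory h)
  choose σ η ε hηε hσ using fun i : Fin (N + 1) => hrel i (Nat.lt_succ_iff.1 i.2)
  choose s hs using fun i : Fin N => hswap i i.2
  -- Only names occurring in η and ε must survive the renaming. The conditions on `σ` and `s` are
  -- identities under all assignments, so any renaming preserves them.
  let S : Finset (GenVar (genericPullback.{u, v, w} E) (L.Term (Fin 3))) :=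
    Finset.univ.biUnion fun i : Fin (N + 1) => Finset.univ.biUnion fun α : Fin 2 =>
      (η i α).varFinset ∪ (ε i α).varFinset
  have hη {i α z} (hz : z ∈ (η i α).varFinset) : z ∈ S := by
    simp only [S, Finset.mem_biUnion, Finset.mem_univ, true_and, Finset.mem_union]
    exact ⟨i, α, .inl hz⟩
  have hε {i α z} (hz : z ∈ (ε i α).varFinset) : z ∈ S := by
    simp only [S, Finset.mem_biUnion, Finset.mem_univ, true_and, Finset.mem_union]
    exact ⟨i, α, .inr hz⟩
  have : Nonempty (L.Term (Fin 3)) := ⟨Term.var 0⟩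
  obtain ⟨k, ι, ρ, hρ⟩ := exists_finite_retraction
    (S.finite_toSet.preimage (f := GenVar.v) fun _ _ _ _ h => GenVar.v.inj h)
  obtain ⟨m, κ, τ, hτ⟩ := exists_finite_retraction
    (S.finite_toSet.preimage (f := GenVar.w) fun _ _ _ _ h => GenVar.w.inj h)
  let R := GenVar.reindex ρ τ
  refine ⟨k, m, N, fun j => freeRep (hom (genericFst E) (ι j)),
    fun j => freeRep (hom (genericSnd E) (ι j)), κ,
    fun i => (s i).relabel (Sum.elim (Sum.elim (SVar.left ∘ R) (SVar.right ∘ R))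
      (Sum.elim (SVar.leftTilde ∘ τ) (SVar.rightTilde ∘ τ))),
    fun i => (σ i).relabel (Sum.elim (Sum.elim (SigmaVar.left ∘ R) (SigmaVar.right ∘ R))
      ![SigmaVar.fst, SigmaVar.snd]),
    fun i α => (η i α).relabel R, fun i α => (ε i α).relabel R,
    fun A => ⟨fun i x => realize_freeRep_diagonal x (ι i), fun i α x y => ?_,
      fun a₁ a₂ b₁ b₂ c₁ c₂ => ?_⟩⟩
  -- A relation of the kernel pair is carried along `χ`; the assignment `y` has to match `χ` only on
  -- names in `S`.
  · have restrict (χ : genericPullback.{u, v, w} E ⟶ A) (y : EtaVar k m → A)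
        (hy : ∀ z ∈ S, y (R z) = hom χ (genericEval E z)) :
        ((η i α).relabel R).realize y = ((ε i α).relabel R).realize y := by
      rw [Term.realize_relabel, Term.realize_relabel]
      refine (realize_congr_of_mem_varFinset fun z hz => hy z (hη hz)).trans
        (Eq.trans ?_ (realize_congr_of_mem_varFinset fun z hz => hy z (hε hz)).symm)
      rw [← realize_hom, ← realize_hom, hηε]
    constructor
    · refine restrict (genericFst E ≫ freeLift ![x, y]) _ fun z hz => ?_
      rw [hom_fst_genericEval]
      cases z with
      | u => rfl
      | v q => simp only [R, GenVar.reindex, EtaVar.args, hρ q hz]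
      | w t => simp only [R, GenVar.reindex, EtaVar.args, hτ t hz]
    · refine restrict (genericSnd E ≫ freeLift ![x, y]) _ fun z hz => ?_
      rw [hom_snd_genericEval]
      cases z with
      | u => rfl
      | v q => simp only [R, GenVar.reindex, EtaVar.args, hρ q hz]
      | w t => simp only [R, GenVar.reindex, EtaVar.args, hτ t hz]
  · have hsig (t : L.Term ((GenVar (genericPullback.{u, v, w} E) (L.Term (Fin 3)) ⊕
        GenVar (genericPullback.{u, v, w} E) (L.Term (Fin 3))) ⊕ Fin 2))
        (l r : EtaVar k m → A) (y z : A) :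
        (t.relabel (Sum.elim (Sum.elim (SigmaVar.left ∘ R) (SigmaVar.right ∘ R))
          ![SigmaVar.fst, SigmaVar.snd])).realize (SigmaVar.args l r y z) =
        t.realize (Sum.elim (Sum.elim (l ∘ R) (r ∘ R)) ![y, z]) := by
      rw [Term.realize_relabel]
      congr 1
      funext i
      rcases i with (i | i) | i
      · rfl
      · rfl
      · fin_cases i <;> rfl
    have hswp (t : L.Term ((GenVar (genericPullback.{u, v, w} E) (L.Term (Fin 3)) ⊕
        GenVar (genericPullback.{u, v, w} E) (L.Term (Fin 3))) ⊕
          (L.Term (Fin 3) ⊕ L.Term (Fin 3))))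
        (l r : EtaVar k m → A) (y z : Fin m → A) :
        (t.relabel (Sum.elim (Sum.elim (SVar.left ∘ R) (SVar.right ∘ R))
          (Sum.elim (SVar.leftTilde ∘ τ) (SVar.rightTilde ∘ τ)))).realize (SVar.args l y r z) =
        t.realize (Sum.elim (Sum.elim (l ∘ R) (r ∘ R)) (Sum.elim (y ∘ τ) (z ∘ τ))) := by
      rw [Term.realize_relabel]
      congr 1
      funext i
      rcases i with (i | i) | (i | i) <;> rfl
    simp only [hsig, hswp, Term.realize_relabel]
    refine ⟨fun i => ⟨?_, ?_⟩, ?_, ?_⟩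
    -- The assignments factor through `R`, which sends `.w t` to `.w (τ t)`; the swapped families
    -- are therefore `c₁ ∘ τ` and `c₂ ∘ τ` by definition.
    · exact (hσ i.castSucc A _ _).2.symm.trans (hs i A _ _).1
    · exact (hs i A _ _).2.symm.trans (hσ i.succ A _ _).1
    · refine Eq.trans ?_ (hσ 0 A _ _).1
      rw [Fin.val_zero, ha]
      rfl
    · refine Eq.trans ?_ (hσ (Fin.last N) A _ _).2
      rw [Fin.val_last, hb]
      rfl

end Generic

end VarietyAlgebra

theorem mainTheorem1 {L : FirstOrder.Language.{u, v}} [L.IsAlgebraic]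
    (E : Set (L.Term ℕ × L.Term ℕ)) :
    IsWeaklyMaltsevCategory (VarietyAlgebra.{u, v, max u w} E) ↔
      ∃ (k m N : ℕ)
        (f g : Fin k → L.Term (Fin 2))
        (p : Fin m → L.Term (Fin 3))
        (s : Fin N → L.Term (SVar k m))
        (σ : Fin (N + 1) → L.Term (SigmaVar k m))
        (η ε : Fin (N + 1) → Fin 2 → L.Term (EtaVar k m)),
        ∀ A : VarietyAlgebra.{u, v, max u w} E,
          (∀ (i : Fin k) (x : A), (f i).realize ![x, x] = (g i).realize ![x, x]) ∧
          (∀ (i : Fin (N + 1)) (α : Fin 2) (x y : A),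
            (η i α).realize (EtaVar.args y (fun j => (f j).realize ![x, y])
                (fun j => (p j).realize ![x, x, y])) =
              (ε i α).realize (EtaVar.args y (fun j => (f j).realize ![x, y])
                (fun j => (p j).realize ![x, x, y])) ∧
            (η i α).realize (EtaVar.args x (fun j => (g j).realize ![x, y])
                (fun j => (p j).realize ![x, y, y])) =
              (ε i α).realize (EtaVar.args x (fun j => (g j).realize ![x, y])
                (fun j => (p j).realize ![x, y, y]))) ∧
          (∀ (a a' : A) (b b' : Fin k → A) (c c' : Fin m → A),
            (∀ i : Fin N,
              (σ i.castSucc).realize (SigmaVar.args (EtaVar.args a b c) (EtaVar.args a' b' c')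
                  ((ε i.castSucc 0).realize (EtaVar.args a b c))
                  ((ε i.castSucc 1).realize (EtaVar.args a' b' c'))) =
                (s i).realize (SVar.args (EtaVar.args a b c) c (EtaVar.args a' b' c') c') ∧
              (s i).realize (SVar.args (EtaVar.args a b c) c' (EtaVar.args a' b' c') c) =
                (σ i.succ).realize (SigmaVar.args (EtaVar.args a b c) (EtaVar.args a' b' c')
                  ((η i.succ 0).realize (EtaVar.args a b c))
                  ((η i.succ 1).realize (EtaVar.args a' b' c')))) ∧
            a = (σ 0).realize (SigmaVar.args (EtaVar.args a b c) (EtaVar.args a' b' c')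
                  ((η 0 0).realize (EtaVar.args a b c))
                  ((η 0 1).realize (EtaVar.args a' b' c'))) ∧
            a' = (σ (Fin.last N)).realize
                  (SigmaVar.args (EtaVar.args a b c) (EtaVar.args a' b' c')
                    ((ε (Fin.last N) 0).realize (EtaVar.args a b c))
                    ((ε (Fin.last N) 1).realize (EtaVar.args a' b' c')))) := by
  constructor
  · exact VarietyAlgebra.exists_terms_of_isWeaklyMaltsevCategory
  · rintro ⟨k, m, N, f, g, p, s, σ, η, ε, H⟩
    exact VarietyAlgebra.isWeaklyMaltsevCategory_of_terms f g p s σ η ε H
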